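/- Let $n>k$ be positive integers and $J=\{1,\dots,n\}$. Let $(b_j^m)_{j\in J,\,1\le m\le k}$ be complex numbers, set $d_{i_1,\dots,i_k}=\det_{l,m=1}^k(b^m_{i_l})$ for $i_1,\dots,i_k\in J$, and assume that $d_{i_1,\dots,i_k}\neq 0$ whenever $i_1,\dots,i_k$ are distinct. Let $a_1,\dots,a_n\in\mathbb C^\times$ with $\sum_{j\in J}a_j\ne 0$. On $\mathbb C^n\times\mathbb C^k$ with coordinates $z_1,\dots,z_n,t_1,\dots,t_k$ put $f_j(z,t)=z_j+\sum_{m=1}^k b_j^m t_m$ for $j\in J$, and for $i_1,\dots,i_{k+1}\in J$ put $$f_{i_1,\dots,i_{k+1}}(z)=\sum_{m=1}^{k+1}(-1)^{m-1}d_{i_1,\dots,\widehat{i_m},\dots,i_{k+1}}\,z_{i_m}.$$ Let $\Delta\subset\mathbb C^n$ be the union of the hyperplanes $f_{i_1,\dots,i_{k+1}}(z)=0$ over all $i_1<\dots<i_{k+1}$ in $J$, and let $$U^0=\{(z,t)\in\mathbb C^n\times\mathbb C^k \mid z\notin\Delta,\ f_j(z,t)\ne0\ \text{for all } j\in J\}.$$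 For a Zariski open subset $W$ of an affine space, $\mathcal O(W)$ denotes the $\mathbb C$-algebra of regular functions on $W$. Let $\Phi=\sum_{j\in J}a_j\log f_j$ be the master function, so that $\partial\Phi/\partial t_i=\sum_{j\in J}b_j^i a_j/f_j\in\mathcal O(U^0)$ for $i=1,\dots,k$. The algebra of functions on the critical set $C_\Phi=\{(z,t)\in U^0\mid \partial\Phi/\partial t_i(z,t)=0,\ i=1,\dots,k\}$ is, by definition, $$A_\Phi=\mathcal O(U^0)/\mathcal I,\qquad \mathcal I=\big(\partial\Phi/\partial t_1,\dots,\partial\Phi/\partial t_k\big);$$ let $[g]\in A_\Phi$ be the class of $g\in\mathcal O(U^0)$. Consider $(\mathbb C^n-\Delta)\times(\mathbb C^\times)^n$ with coordinates $z_1,\dots,z_n,p_1,\dots,p_n$, and let $\tilde{\mathcal I}\subset\mathcal O((\mathbb C^n-\Delta)\times(\mathbb C^\times)^n)$ be the ideal generated by the functions (relations of first kind) $$F_I(p)=\sum_{j\in J}d_{j,i_1,\dots,i_{k-1}}\,p_j$$ for all $I=\{i_1,\dots,i_{k-1}\}\subset J$ with distinct elements, and the functions (relations of second kind) $$F_I(z,p)=p_{i_1}\cdots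 p_{i_{k+1}}\,f_{i_1,\dots,i_{k+1}}(z)+\sum_{m=1}^{k+1}(-1)^m a_{i_m}d_{i_1,\dots,\widehat{i_m},\dots,i_{k+1}}\,p_{i_1}\cdots\widehat{p_{i_m}}\cdots p_{i_{k+1}}$$ for all $I=\{i_1,\dots,i_{k+1}\}\subset J$ with distinct elements. Let $\tilde A=\mathcal O((\mathbb C^n-\Delta)\times(\mathbb C^\times)^n)/\tilde{\mathcal I}$. Then there is a unique isomorphism of $\mathbb C$-algebras $\tilde A\to A_\Phi$ that maps the class of $z_j$ to $[z_j]$ and the class of $p_j$ to $[a_j/f_j]$ for all $j\in J$. -/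

import Mathlib

namespace GenericArrangement

/-! ### Regular functions -/

section Regular

variable {σ : Type*}

/-- The algebra `𝒪(W)` of regular functions on a (Zariski open) subset `W` of the affine space
`ℂ^σ`: the functions `W → ℂ` that near every point of `W`, in the Zariski topology, are a quotient
of two polynomials. -/
def regularFunctions (W : Set (σ → ℂ)) : Subalgebra ℂ (W → ℂ) where
  carrier := {g | ∀ x : W, ∃ P Q : MvPolynomial σ ℂ, MvPolynomial.eval x.1 Q ≠ 0 ∧
    ∀ y : W, MvPolynomial.eval y.1 Q ≠ 0 →
      g y = MvPolynomial.eval y.1 P / MvPolynomial.eval y.1 Q}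
  mul_mem' := by
    intro g h hg hh x
    obtain ⟨P, Q, hQ, hPQ⟩ := hg x
    obtain ⟨R, S, hS, hRS⟩ := hh x
    refine ⟨P * R, Q * S, by simp [hQ, hS], fun y hy => ?_⟩
    rw [map_mul] at hy
    rw [Pi.mul_apply, hPQ y (left_ne_zero_of_mul hy), hRS y (right_ne_zero_of_mul hy),
      map_mul, map_mul, div_mul_div_comm]
  add_mem' := by
    intro g h hg hh x
    obtain ⟨P, Q, hQ, hPQ⟩ := hg x
    obtain ⟨R, S, hS, hRS⟩ := hh x
    refine ⟨P * S + Q * R, Q * S, by simp [hQ, hS], fun y hy => ?_⟩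
    rw [map_mul] at hy
    rw [Pi.add_apply, hPQ y (left_ne_zero_of_mul hy), hRS y (right_ne_zero_of_mul hy),
      div_add_div _ _ (left_ne_zero_of_mul hy) (right_ne_zero_of_mul hy)]
    simp
  algebraMap_mem' := by
    intro c x
    exact ⟨MvPolynomial.C c, 1, by simp, fun y _ => by simp⟩

/-- A polynomial restricted to `W`, as a regular function. -/
noncomputable def restrict (W : Set (σ → ℂ)) (P : MvPolynomial σ ℂ) : regularFunctions W :=
  ⟨fun x => MvPolynomial.eval x.1 P, fun _ => ⟨P, 1, by simp, fun y _ => by simp⟩⟩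

/-- A coordinate function restricted to `W`. -/
noncomputable def coord (W : Set (σ → ℂ)) (s : σ) : regularFunctions W :=
  restrict W (MvPolynomial.X s)

/-- The regular function `P / Q` on `W`, where `Q` has no zero in `W`. -/
noncomputable def quotient (W : Set (σ → ℂ)) (P Q : MvPolynomial σ ℂ)
    (hQ : ∀ x ∈ W, MvPolynomial.eval x Q ≠ 0) : regularFunctions W :=
  ⟨fun x => MvPolynomial.eval x.1 P / MvPolynomial.eval x.1 Q,
    fun x => ⟨P, Q, hQ x.1 x.2, fun _ _ => rfl⟩⟩

end Regular

variable {n k : ℕ}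

/-! ### The arrangement -/

/-- The number `d_{i₁,…,i_k}`, the determinant of the rows `i₁, …, i_k` of `b`.  The entry
`b j m` is the coefficient of `t_m` in the linear function `g_j`. -/
def d (b : Matrix (Fin n) (Fin k) ℂ) (i : Fin k → Fin n) : ℂ :=
  (b.submatrix i id).det

/-- The function `f_j(z,t) = z_j + g_j(t)` on `ℂⁿ × ℂᵏ`, as a polynomial; the variables `z_j` are
indexed by `Sum.inl`, the variables `t_m` by `Sum.inr`. -/
noncomputable def f (b : Matrix (Fin n) (Fin k) ℂ) (j : Fin n) :
    MvPolynomial (Fin n ⊕ Fin k) ℂ :=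
  MvPolynomial.X (Sum.inl j) + ∑ m, MvPolynomial.C (b j m) * MvPolynomial.X (Sum.inr m)

/-- The linear function `f_{i₁,…,i_{k+1}}(z) = ∑_m (-1)^{m-1} d_{i₁,…,î_m,…,i_{k+1}} z_{i_m}`
on `ℂⁿ` (here `m` starts from `0`). -/
def fI (b : Matrix (Fin n) (Fin k) ℂ) (i : Fin (k + 1) → Fin n) (z : Fin n → ℂ) : ℂ :=
  ∑ m : Fin (k + 1), (-1) ^ (m : ℕ) * d b (i ∘ m.succAbove) * z (i m)

/-- The discriminant `Δ ⊂ ℂⁿ`, the union of the hyperplanes `f_{i₁,…,i_{k+1}} = 0` over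
`i₁ < … < i_{k+1}`. -/
def Delta (b : Matrix (Fin n) (Fin k) ℂ) : Set (Fin n → ℂ) :=
  {z | ∃ i : Fin (k + 1) → Fin n, StrictMono i ∧ fI b i z = 0}

/-- The set `U⁰ ⊂ ℂⁿ × ℂᵏ` of all `(z,t)` with `z ∉ Δ` and `f_j(z,t) ≠ 0` for all `j`. -/
def U0 (b : Matrix (Fin n) (Fin k) ℂ) : Set (Fin n ⊕ Fin k → ℂ) :=
  {x | (∀ j, MvPolynomial.eval x (f b j) ≠ 0) ∧ x ∘ Sum.inl ∉ Delta b}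

/-- The set `(ℂⁿ - Δ) × (ℂ^×)ⁿ` with coordinates `z_j` (indexed by `Sum.inl`) and `p_j` (indexed
by `Sum.inr`). -/
def phaseSpace (b : Matrix (Fin n) (Fin k) ℂ) : Set (Fin n ⊕ Fin n → ℂ) :=
  {y | y ∘ Sum.inl ∉ Delta b ∧ ∀ j, y (Sum.inr j) ≠ 0}

/-! ### The algebra of functions on the critical set -/

/-- The regular function `a_j / f_j` on `U⁰`. -/
noncomputable def aDivF (b : Matrix (Fin n) (Fin k) ℂ) (a : Fin n → ℂ) (j : Fin n) :
    regularFunctions (U0 b) :=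
  quotient (U0 b) (MvPolynomial.C (a j)) (f b j) (fun _ hx => hx.1 j)

/-- The regular function `∂Φ/∂t_i = ∑_j b_j^i a_j / f_j` on `U⁰`, where
`Φ = ∑_j a_j log f_j` is the master function. -/
noncomputable def derivPhi (b : Matrix (Fin n) (Fin k) ℂ) (a : Fin n → ℂ) (i : Fin k) :
    regularFunctions (U0 b) :=
  ∑ j, b j i • aDivF b a j

/-- `derivPhi` is the partial derivative of the master function: if `L j` are local holomorphic
branches of `log f_j` along the `t_i`-line through `x`, then the derivative of `∑_j a_j L_j`
at `x` is the value of `derivPhi b a i` at `x`. -/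
theorem hasDerivAt_masterFunction (b : Matrix (Fin n) (Fin k) ℂ) (a : Fin n → ℂ) (i : Fin k)
    (x : U0 b) (L : Fin n → ℂ → ℂ)
    (hd : ∀ j, DifferentiableAt ℂ (L j) (x.1 (Sum.inr i)))
    (hL : ∀ j, ∀ᶠ s in nhds (x.1 (Sum.inr i)),
      Complex.exp (L j s) = MvPolynomial.eval (Function.update x.1 (Sum.inr i) s) (f b j)) :
    HasDerivAt (fun s => ∑ j, a j * L j s) ((derivPhi b a i).1 x) (x.1 (Sum.inr i)) := by
  have hval : (derivPhi b a i).1 x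
      = ∑ j, a j * (b j i / MvPolynomial.eval x.1 (f b j)) := by
    simp only [derivPhi, AddSubmonoidClass.coe_finsetSum, Finset.sum_apply]
    refine Finset.sum_congr rfl fun j _ => ?_
    simp [aDivF, quotient]
    ring
  rw [hval]
  refine HasDerivAt.fun_sum fun j _ => HasDerivAt.const_mul _ ?_
  have h1 := (hd j).hasDerivAt
  have h2 := h1.cexp
  have h3 : HasDerivAt (fun s => MvPolynomial.eval (Function.update x.1 (Sum.inr i) s) (f b j))
      (b j i) (x.1 (Sum.inr i)) := by
    have h4 : ∀ s, MvPolynomial.eval (Function.update x.1 (Sum.inr i) s) (f b j)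
        = b j i * s + (x.1 (Sum.inl j) + ∑ m ∈ Finset.univ.erase i, b j m * x.1 (Sum.inr m)) := by
      intro s
      simp only [f, map_add, map_sum, map_mul, MvPolynomial.eval_X, MvPolynomial.eval_C]
      rw [← Finset.add_sum_erase _ _ (Finset.mem_univ i)]
      have : ∀ m ∈ Finset.univ.erase i,
          b j m * Function.update x.1 (Sum.inr i) s (Sum.inr m) = b j m * x.1 (Sum.inr m) := by
        intro m hm
        rw [Function.update_of_ne (by simpa using Finset.ne_of_mem_erase hm)]
      rw [Finset.sum_congr rfl this]
      simp
      ring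
    simp only [h4]
    simpa using ((hasDerivAt_id (x.1 (Sum.inr i))).const_mul (b j i)).add_const
      (x.1 (Sum.inl j) + ∑ m ∈ Finset.univ.erase i, b j m * x.1 (Sum.inr m))
  have h5 := h2.unique (h3.congr_of_eventuallyEq (hL j))
  have h6 : Complex.exp (L j (x.1 (Sum.inr i))) = MvPolynomial.eval x.1 (f b j) := by
    simpa using (hL j).self_of_nhds
  have h7 : deriv (L j) (x.1 (Sum.inr i)) = b j i / MvPolynomial.eval x.1 (f b j) := by
    rw [eq_div_iff (x.2.1 j), ← h5, h6, mul_comm]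
  rwa [h7] at h1

/-- The ideal of `𝒪(U⁰)` generated by `∂Φ/∂t_1, …, ∂Φ/∂t_k`. -/
noncomputable def critIdeal (b : Matrix (Fin n) (Fin k) ℂ) (a : Fin n → ℂ) :
    Ideal (regularFunctions (U0 b)) :=
  Ideal.span (Set.range (derivPhi b a))

/-- The algebra `A_Φ` of functions on the critical set `C_Φ` of `Φ` with respect to `t`. -/
abbrev CritAlgebra (b : Matrix (Fin n) (Fin k) ℂ) (a : Fin n → ℂ) : Type :=
  regularFunctions (U0 b) ⧸ critIdeal b a

/-! ### The algebra given by generators and relations -/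

/-- The coordinate function `z_j` on `(ℂⁿ - Δ) × (ℂ^×)ⁿ`. -/
noncomputable def zCoord (b : Matrix (Fin n) (Fin k) ℂ) (j : Fin n) :
    regularFunctions (phaseSpace b) :=
  coord (phaseSpace b) (Sum.inl j)

/-- The coordinate function `p_j` on `(ℂⁿ - Δ) × (ℂ^×)ⁿ`. -/
noncomputable def pCoord (b : Matrix (Fin n) (Fin k) ℂ) (j : Fin n) :
    regularFunctions (phaseSpace b) :=
  coord (phaseSpace b) (Sum.inr j)

/-- The sequence `(j, i₁, …, i_{k-1})`. -/
def prepend (j : Fin n) (i : Fin (k - 1) → Fin n) : Fin k → Fin n :=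
  fun l => if h : (l : ℕ) = 0 then j else i ⟨(l : ℕ) - 1, by omega⟩

/-- The left side `F_I(p) = ∑_j d_{j,i₁,…,i_{k-1}} p_j` of the relation of first kind. -/
noncomputable def firstKind (b : Matrix (Fin n) (Fin k) ℂ) (i : Fin (k - 1) → Fin n) :
    regularFunctions (phaseSpace b) :=
  ∑ j, d b (prepend j i) • pCoord b j

/-- The left side of the relation of second kind, `F_I(z,p) = p_{i₁} ⋯ p_{i_{k+1}} f_I(z) +
∑_m (-1)^m a_{i_m} d_{i₁,…,î_m,…,i_{k+1}} p_{i₁} ⋯ p̂_{i_m} ⋯ p_{i_{k+1}}`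
(in the code `m` starts from `0`, whence the exponent `m + 1`). -/
noncomputable def secondKind (b : Matrix (Fin n) (Fin k) ℂ) (a : Fin n → ℂ)
    (i : Fin (k + 1) → Fin n) : regularFunctions (phaseSpace b) :=
  (∏ m, pCoord b (i m)) *
      (∑ m : Fin (k + 1), ((-1) ^ (m : ℕ) * d b (i ∘ m.succAbove)) • zCoord b (i m)) +
    ∑ m : Fin (k + 1), ((-1) ^ ((m : ℕ) + 1) * a (i m) * d b (i ∘ m.succAbove)) •
      ∏ l ∈ Finset.univ.erase m, pCoord b (i l)

/-- The ideal of `𝒪((ℂⁿ - Δ) × (ℂ^×)ⁿ)` generated by all `F_I` of first and second kind. -/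
noncomputable def relIdeal (b : Matrix (Fin n) (Fin k) ℂ) (a : Fin n → ℂ) :
    Ideal (regularFunctions (phaseSpace b)) :=
  Ideal.span
    ({F | ∃ i : Fin (k - 1) → Fin n, Function.Injective i ∧ F = firstKind b i} ∪
      {F | ∃ i : Fin (k + 1) → Fin n, Function.Injective i ∧ F = secondKind b a i})

/-- The quotient algebra `Ã` of `𝒪((ℂⁿ - Δ) × (ℂ^×)ⁿ)` by the relations. -/
abbrev RelAlgebra (b : Matrix (Fin n) (Fin k) ℂ) (a : Fin n → ℂ) : Type :=
  regularFunctions (phaseSpace b) ⧸ relIdeal b a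

end GenericArrangement

/-! Both open sets are principal, so by the Nullstellensatz their regular functions are polynomial
rings with one element inverted. A homomorphism out of them is given by the images of the
coordinates, provided the inverted polynomial goes to a unit (`exists_lift_restrictHom`,
`algHom_ext_coord`).

Write `q_j = a_j / p_j`. A relation of second kind is the unit `∏ p_{i_m}` times `f_I(z - q)`
(`secondKind_factorization`). The forms `f_I` vanish on the column space of `b`
(`sum_d_smul_affine`), and their common vanishing forces `q = z + b t` for some `t`
(`eq_affine_of_eq_on_basis`): these relations say precisely that `q_j = f_j(z,t)`. The relations of
first kind are cofactor combinations of `∑_j b_j^m p_j`; as some `k × k` minor of `b` is invertible,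
they generate the same ideal as these sums, which become `∂Φ/∂t_m` under `p_j = a_j / f_j`.

Hence `p_j ↦ a_j / f_j` descends to the quotients, and solving `z + b t = q` by Cramer's rule inside
`Ã` gives a homomorphism back. The composites fix the `z_j` and `p_j` (or `a_j / f_j`), which
determine every homomorphism. -/

namespace GenericArrangement

/-! ### Regular functions on a principal open set -/

section Regular

open MvPolynomial

variable {σ : Type*}

/-- Restriction of polynomials to `W`, as a homomorphism of algebras. -/
noncomputable def restrictHom (W : Set (σ → ℂ)) :
    MvPolynomial σ ℂ →ₐ[ℂ] regularFunctions W where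
  toFun := restrict W
  map_one' := by ext x; simp [restrict]
  map_mul' P Q := by ext x; simp [restrict]
  map_zero' := by ext x; simp [restrict]
  map_add' P Q := by ext x; simp [restrict]
  commutes' c := by ext x; simp [restrict]

@[simp]
theorem restrictHom_apply (W : Set (σ → ℂ)) (P : MvPolynomial σ ℂ) (x : W) :
    (restrictHom W P).1 x = eval x.1 P := rfl

theorem restrictHom_X (W : Set (σ → ℂ)) (s : σ) : restrictHom W (X s) = coord W s := rfl

theorem isUnit_restrictHom (W : Set (σ → ℂ)) {P : MvPolynomial σ ℂ}
    (hP : ∀ x ∈ W, eval x P ≠ 0) : IsUnit (restrictHom W P) := by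
  refine IsUnit.of_mul_eq_one (quotient W 1 P hP) ?_
  ext x
  simpa [quotient] using mul_inv_cancel₀ (hP x.1 x.2)

/-- The ideal of polynomial denominators of a regular function. -/
noncomputable def denominators {W : Set (σ → ℂ)} (g : regularFunctions W) :
    Ideal (MvPolynomial σ ℂ) where
  carrier := {Q | ∃ P, restrictHom W Q * g = restrictHom W P}
  zero_mem' := ⟨0, by simp⟩
  add_mem' := by
    rintro Q R ⟨P, hP⟩ ⟨S, hS⟩
    exact ⟨P + S, by rw [map_add, map_add, add_mul, hP, hS]⟩
  smul_mem' := by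
    rintro c Q ⟨P, hP⟩
    exact ⟨c * P, by rw [smul_eq_mul, map_mul, map_mul, mul_assoc, hP]⟩

/-- A regular function on the principal open set `h ≠ 0` is a polynomial divided by a power
of `h`. -/
theorem exists_pow_mul_eq_restrictHom [Finite σ] {W : Set (σ → ℂ)} {h : MvPolynomial σ ℂ}
    (hW : ∀ x, x ∈ W ↔ eval x h ≠ 0) (g : regularFunctions W) :
    ∃ (m : ℕ) (P : MvPolynomial σ ℂ), restrictHom W (h ^ m) * g = restrictHom W P := by
  -- By the Nullstellensatz, it suffices that `h` vanishes wherever all denominators of `g` vanish.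
  suffices h ∈ (denominators g).radical from this
  rw [← MvPolynomial.vanishingIdeal_zeroLocus_eq_radical (k := ℂ) (K := ℂ),
    MvPolynomial.mem_vanishingIdeal_iff]
  intro x hx
  by_contra hne
  have hxW : x ∈ W := (hW x).2 (by simpa [coe_aeval_eq_eval] using hne)
  obtain ⟨P, Q, hQ, hPQ⟩ := g.2 ⟨x, hxW⟩
  -- `Q` itself may fail: `P` need not vanish at the points of `W` where `Q` does. The extra factor
  -- `Q` makes both sides zero there.
  have hmem : Q * Q ∈ denominators g := by
    refine ⟨Q * P, ?_⟩
    ext y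
    by_cases hy : eval y.1 Q = 0
    · simp [hy]
    · have := hPQ y hy
      simp only [map_mul, MulMemClass.coe_mul, Pi.mul_apply, restrictHom_apply, this]
      field_simp
  have h0 := hx (Q * Q) hmem
  simp at h0
  exact hQ h0

/-- `P` vanishes on `W` and `h` off `W`, and a polynomial over `ℂ` is determined by its values.
Keeping the factor `h` covers the case `h = 0`, where `W` is empty. -/
theorem mul_eq_zero_of_restrictHom_eq_zero {W : Set (σ → ℂ)} {h P : MvPolynomial σ ℂ}
    (hW : ∀ x, x ∈ W ↔ eval x h ≠ 0) (hP : restrictHom W P = 0) : h * P = 0 := by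
  refine MvPolynomial.funext fun x => ?_
  rw [map_mul, map_zero]
  by_cases hx : eval x h = 0
  · simp [hx]
  · have := congrArg (fun g => g.1 ⟨x, (hW x).2 hx⟩) hP
    simp only [restrictHom_apply] at this
    rw [this]
    simp

/-- The regular functions on the principal open set `h ≠ 0` are the localization of the
polynomial ring away from `h`. -/
theorem isLocalization_restrictHom [Finite σ] {W : Set (σ → ℂ)} {h : MvPolynomial σ ℂ}
    (hW : ∀ x, x ∈ W ↔ eval x h ≠ 0) :
    @IsLocalization.Away _ _ h (regularFunctions W) _ (restrictHom W).toRingHom.toAlgebra := by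
  let := (restrictHom W).toRingHom.toAlgebra
  have hu : IsUnit (restrictHom W h) := isUnit_restrictHom W fun x hx => (hW x).1 hx
  refine ⟨?_, ?_, ?_⟩
  · rintro ⟨_, m, rfl⟩
    change IsUnit (restrictHom W (h ^ m))
    rw [map_pow]
    exact hu.pow m
  · intro g
    obtain ⟨m, P, hP⟩ := exists_pow_mul_eq_restrictHom hW g
    exact ⟨(P, ⟨h ^ m, m, rfl⟩), by rw [mul_comm]; exact hP⟩
  · intro P Q hPQ
    have hPQ' : restrictHom W (P - Q) = 0 := by
      rw [map_sub]
      exact sub_eq_zero.2 hPQ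
    refine ⟨⟨h, 1, pow_one h⟩, ?_⟩
    have := mul_eq_zero_of_restrictHom_eq_zero hW hPQ'
    rwa [mul_sub, sub_eq_zero] at this

/-- Universal property of the regular functions on a principal open set: existence. -/
theorem exists_lift_restrictHom [Finite σ] {R : Type*} [CommRing R] [Algebra ℂ R]
    {W : Set (σ → ℂ)} {h : MvPolynomial σ ℂ} (hW : ∀ x, x ∈ W ↔ eval x h ≠ 0)
    (φ : MvPolynomial σ ℂ →ₐ[ℂ] R) (hφ : IsUnit (φ h)) :
    ∃ ψ : regularFunctions W →ₐ[ℂ] R, ∀ P, ψ (restrictHom W P) = φ P := by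
  let := (restrictHom W).toRingHom.toAlgebra
  have := isLocalization_restrictHom hW
  have key : ∀ P, IsLocalization.Away.lift (S := regularFunctions W) h (g := φ.toRingHom) hφ
      (restrictHom W P) = φ P := fun P => IsLocalization.Away.lift_eq h hφ P
  refine ⟨{ IsLocalization.Away.lift (S := regularFunctions W) h (g := φ.toRingHom) hφ with
    commutes' := fun c => ?_ }, key⟩
  have := key (algebraMap ℂ _ c)
  rwa [AlgHom.commutes, AlgHom.commutes] at this

/-- Universal property of the regular functions on a principal open set: uniqueness. -/
theorem algHom_ext_coord [Finite σ] {R : Type*} [CommRing R] [Algebra ℂ R]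
    {W : Set (σ → ℂ)} {h : MvPolynomial σ ℂ} (hW : ∀ x, x ∈ W ↔ eval x h ≠ 0)
    {φ ψ : regularFunctions W →ₐ[ℂ] R} (hφψ : ∀ s, φ (coord W s) = ψ (coord W s)) : φ = ψ := by
  have hpoly : ∀ P, φ (restrictHom W P) = ψ (restrictHom W P) := by
    have : φ.comp (restrictHom W) = ψ.comp (restrictHom W) := MvPolynomial.algHom_ext hφψ
    exact fun P => DFunLike.congr_fun this P
  ext g
  obtain ⟨m, P, hP⟩ := exists_pow_mul_eq_restrictHom hW g
  have hu : IsUnit (restrictHom W (h ^ m)) := by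
    rw [map_pow]
    exact (isUnit_restrictHom W fun x hx => (hW x).1 hx).pow m
  refine (hu.map φ).mul_left_cancel ?_
  rw [← map_mul, hP, hpoly, hpoly, ← map_mul, hP]

end Regular

/-! ### The two principal open sets -/

section OpenSets

open MvPolynomial

variable {n k : ℕ} {τ : Type*}

/-- The function `f_{i₁,…,i_{k+1}}(z)` as a polynomial. -/
noncomputable def fIPoly (τ : Type*) (b : Matrix (Fin n) (Fin k) ℂ) (i : Fin (k + 1) → Fin n) :
    MvPolynomial (Fin n ⊕ τ) ℂ :=
  ∑ m : Fin (k + 1), ((-1) ^ (m : ℕ) * d b (i ∘ m.succAbove)) • X (Sum.inl (i m))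

theorem eval_fIPoly (b : Matrix (Fin n) (Fin k) ℂ) (i : Fin (k + 1) → Fin n)
    (x : Fin n ⊕ τ → ℂ) : eval x (fIPoly τ b i) = fI b i (x ∘ Sum.inl) := by
  simp [fIPoly, fI, smul_eval]

open Classical in
/-- The product of the equations of the hyperplanes in `Δ`. -/
noncomputable def discriminantPoly (τ : Type*) (b : Matrix (Fin n) (Fin k) ℂ) :
    MvPolynomial (Fin n ⊕ τ) ℂ :=
  ∏ i ∈ Finset.univ.filter (fun i : Fin (k + 1) → Fin n => StrictMono i), fIPoly τ b i

theorem eval_discriminantPoly_ne_zero (b : Matrix (Fin n) (Fin k) ℂ) (x : Fin n ⊕ τ → ℂ) :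
    eval x (discriminantPoly τ b) ≠ 0 ↔ x ∘ Sum.inl ∉ Delta b := by
  simp [discriminantPoly, map_prod, Finset.prod_ne_zero_iff, eval_fIPoly, Delta]

theorem mem_U0_iff (b : Matrix (Fin n) (Fin k) ℂ) (x : Fin n ⊕ Fin k → ℂ) :
    x ∈ U0 b ↔ eval x ((∏ j, f b j) * discriminantPoly (Fin k) b) ≠ 0 := by
  rw [map_mul, mul_ne_zero_iff, eval_discriminantPoly_ne_zero, map_prod, Finset.prod_ne_zero_iff]
  simp [U0]

theorem mem_phaseSpace_iff (b : Matrix (Fin n) (Fin k) ℂ) (y : Fin n ⊕ Fin n → ℂ) :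
    y ∈ phaseSpace b ↔
      eval y ((∏ j, X (Sum.inr j)) * discriminantPoly (Fin n) b) ≠ 0 := by
  rw [map_mul, mul_ne_zero_iff, eval_discriminantPoly_ne_zero, map_prod, Finset.prod_ne_zero_iff]
  simp [phaseSpace, and_comm]

/-- The image of the discriminant depends only on the images of the `z_j`. -/
theorem map_discriminantPoly_congr {τ' R : Type*} [CommRing R] [Algebra ℂ R]
    (b : Matrix (Fin n) (Fin k) ℂ) (φ : MvPolynomial (Fin n ⊕ τ) ℂ →ₐ[ℂ] R)
    (ψ : MvPolynomial (Fin n ⊕ τ') ℂ →ₐ[ℂ] R)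
    (h : ∀ j, φ (X (Sum.inl j)) = ψ (X (Sum.inl j))) :
    φ (discriminantPoly τ b) = ψ (discriminantPoly τ' b) := by
  simp only [discriminantPoly, fIPoly, map_prod, map_sum, map_smul, h]

theorem isUnit_discriminantPoly {W : Set (Fin n ⊕ τ → ℂ)} (b : Matrix (Fin n) (Fin k) ℂ)
    (hW : ∀ x ∈ W, x ∘ Sum.inl ∉ Delta b) : IsUnit (restrictHom W (discriminantPoly τ b)) :=
  isUnit_restrictHom W fun x hx => (eval_discriminantPoly_ne_zero b x).2 (hW x hx)

end OpenSets

/-! ### Determinant identities -/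

section Determinants

variable {n k : ℕ} {R : Type*} [CommRing R] [Algebra ℂ R]

/-- Prepend a second copy of column `l` to the rows `i` of `b`: the determinant has two equal
columns, and the sum is its expansion along the new one. -/
theorem sum_d_succAbove_mul_eq_zero (b : Matrix (Fin n) (Fin k) ℂ) (i : Fin (k + 1) → Fin n)
    (l : Fin k) : ∑ m : Fin (k + 1), (-1) ^ (m : ℕ) * d b (i ∘ m.succAbove) * b (i m) l = 0 := by
  let M : Matrix (Fin (k + 1)) (Fin (k + 1)) ℂ :=
    Matrix.of fun r => Fin.cons (b (i r) l) (b (i r))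
  have h0 : M.det = 0 :=
    Matrix.det_zero_of_column_eq (Fin.succ_ne_zero l).symm fun r => by simp [M]
  rw [Matrix.det_succ_column_zero] at h0
  rw [← h0]
  refine Finset.sum_congr rfl fun m _ => ?_
  have : M.submatrix m.succAbove Fin.succ = b.submatrix (i ∘ m.succAbove) id := by
    ext r c
    simp [M]
  rw [this, d]
  simp only [M, Matrix.of_apply, Fin.cons_zero]
  ring

/-- `f_I` kills the columns of `b`, so the `t`-part of the `f_j` drops out. -/
theorem sum_d_smul_affine (b : Matrix (Fin n) (Fin k) ℂ) (i : Fin (k + 1) → Fin n)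
    (z : Fin n → R) (t : Fin k → R) :
    ∑ m : Fin (k + 1), ((-1) ^ (m : ℕ) * d b (i ∘ m.succAbove)) •
        (z (i m) + ∑ l, b (i m) l • t l) =
      ∑ m : Fin (k + 1), ((-1) ^ (m : ℕ) * d b (i ∘ m.succAbove)) • z (i m) := by
  simp only [smul_add, Finset.sum_add_distrib, Finset.smul_sum, smul_smul]
  rw [Finset.sum_comm]
  simp only [← Finset.sum_smul, sum_d_succAbove_mul_eq_zero, zero_smul, Finset.sum_const_zero,
    add_zero]

/-- If `p_j q_j = a_j`, the left side of a relation of second kind is the product of the `p_j`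
and a linear form in the `z_j` and `q_j`. -/
theorem secondKind_factorization (b : Matrix (Fin n) (Fin k) ℂ) (a : Fin n → ℂ)
    (i : Fin (k + 1) → Fin n) (z p q : Fin n → R) (hpq : ∀ j, p j * q j = algebraMap ℂ R (a j)) :
    (∏ m, p (i m)) * (∑ m : Fin (k + 1), ((-1) ^ (m : ℕ) * d b (i ∘ m.succAbove)) • z (i m)) +
        ∑ m : Fin (k + 1), ((-1) ^ ((m : ℕ) + 1) * a (i m) * d b (i ∘ m.succAbove)) •
          ∏ l ∈ Finset.univ.erase m, p (i l) =
      (∏ m, p (i m)) *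
        (∑ m : Fin (k + 1), ((-1) ^ (m : ℕ) * d b (i ∘ m.succAbove)) • (z (i m) - q (i m))) := by
  simp only [Finset.mul_sum, ← Finset.sum_add_distrib]
  refine Finset.sum_congr rfl fun m _ => ?_
  -- Splitting off `p_{i_m}` lets it meet `q_{i_m}` and produce `a_{i_m}`, term by term.
  have h1 := Finset.mul_prod_erase Finset.univ (fun l => p (i l)) (Finset.mem_univ m)
  rw [← h1]
  have h2 := hpq (i m)
  simp only [Algebra.smul_def, map_mul, map_pow, map_neg, map_one, ← h2]
  ring

/-- Expansion along the first row, the only one involving `j`. With `k + 1` columns the index type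
`Fin (k + 1 - 1)` is definitionally `Fin k`. -/
theorem d_prepend (b : Matrix (Fin n) (Fin (k + 1)) ℂ) (i : Fin k → Fin n) (j : Fin n) :
    d b (prepend (k := k + 1) j i) =
      ∑ m : Fin (k + 1), (-1) ^ (m : ℕ) * (b.submatrix i m.succAbove).det * b j m := by
  rw [d, Matrix.det_succ_row_zero]
  refine Finset.sum_congr rfl fun m _ => ?_
  have : (b.submatrix (prepend (k := k + 1) j i) id).submatrix Fin.succ m.succAbove =
      b.submatrix i m.succAbove := by
    ext r c
    simp [prepend]
  have h0 : prepend (k := k + 1) j i 0 = j := rfl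
  rw [this, Matrix.submatrix_apply, h0, id]
  ring

/-- The linear forms `∑_j d_{j,i₁,…,i_{k-1}} p_j` are combinations of the `∑_j b_j^m p_j`. -/
theorem sum_d_prepend_smul (b : Matrix (Fin n) (Fin (k + 1)) ℂ) (i : Fin k → Fin n)
    (p : Fin n → R) :
    ∑ j, d b (prepend (k := k + 1) j i) • p j =
      ∑ m : Fin (k + 1), ((-1) ^ (m : ℕ) * (b.submatrix i m.succAbove).det) •
        ∑ j, b j m • p j := by
  simp only [d_prepend, Finset.sum_smul, Finset.smul_sum, smul_smul]
  exact Finset.sum_comm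

/-- The relations of first kind imply the vanishing of all `∑_j b_j^m p_j`. -/
theorem sum_smul_eq_zero_of_firstKind (b : Matrix (Fin n) (Fin (k + 1)) ℂ) (p : Fin n → R)
    {i : Fin (k + 1) → Fin n} (hi : Function.Injective i) (hd : d b i ≠ 0)
    (h : ∀ i' : Fin k → Fin n, Function.Injective i' →
      ∑ j, d b (prepend (k := k + 1) j i') • p j = 0) (m : Fin (k + 1)) :
    ∑ j, b j m • p j = 0 := by
  set v : Fin (k + 1) → R := fun m => ∑ j, b j m • p j with hv
  set B : Matrix (Fin (k + 1)) (Fin (k + 1)) R := (b.submatrix i id).map (algebraMap ℂ R) with hB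
  -- Entry `r` is the determinant of `B` with row `r` replaced by `v`, which up to sign is the
  -- relation of first kind for `i` with `i_r` omitted. Since `Bᵀ` times the Cramer vector is `det B
  -- • v` and `det B` is a unit, `v = 0` follows.
  have hcr : B.transpose.cramer v = 0 := by
    ext r
    rw [Matrix.cramer_transpose_apply, Matrix.det_succ_row _ r]
    have := h (i ∘ r.succAbove) (hi.comp Fin.succAbove_right_injective)
    rw [sum_d_prepend_smul] at this
    rw [Pi.zero_apply, ← mul_zero ((-1) ^ (r : ℕ)), ← this, Finset.mul_sum]
    refine Finset.sum_congr rfl fun c _ => ?_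
    have hs : (B.updateRow r v).submatrix r.succAbove c.succAbove =
        (b.submatrix (i ∘ r.succAbove) c.succAbove).map (algebraMap ℂ R) := by
      ext x y
      simp [B, Matrix.updateRow_ne]
    rw [hs, ← RingHom.mapMatrix_apply, ← RingHom.map_det, Matrix.updateRow_self,
      Algebra.smul_def]
    simp only [map_mul, map_pow, map_neg, map_one, pow_add]
    ring
  have hmul := Matrix.mulVec_cramer B.transpose v
  rw [hcr, Matrix.mulVec_zero, Matrix.det_transpose, hB, ← RingHom.mapMatrix_apply,
    ← RingHom.map_det] at hmul
  have hu : IsUnit (algebraMap ℂ R (b.submatrix i id).det) :=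
    (isUnit_iff_ne_zero.2 hd).map _
  have := congrFun hmul m
  rw [Pi.zero_apply, Pi.smul_apply, smul_eq_mul] at this
  exact hu.mul_right_eq_zero.1 this.symm

/-- Cramer's rule: there is a unique `t` with `∑_l b_j^l t_l = w_j` for `j = i₁, …, i_k`. -/
theorem exists_unique_solution (b : Matrix (Fin n) (Fin k) ℂ) {i : Fin k → Fin n}
    (hd : d b i ≠ 0) (w : Fin k → R) :
    ∃! t : Fin k → R, ∀ m, ∑ l, b (i m) l • t l = w m := by
  set B : Matrix (Fin k) (Fin k) R := (b.submatrix i id).map (algebraMap ℂ R) with hB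
  have hu : IsUnit B.det := by
    rw [hB, ← RingHom.mapMatrix_apply, ← RingHom.map_det]
    exact (isUnit_iff_ne_zero.2 hd).map _
  have hBt : ∀ t : Fin k → R, (∀ m, ∑ l, b (i m) l • t l = w m) ↔ B.mulVec t = w := by
    intro t
    rw [funext_iff]
    simp [B, Matrix.mulVec, dotProduct, Algebra.smul_def]
  simp only [hBt]
  refine ⟨B⁻¹.mulVec w, ?_, fun t ht => ?_⟩
  · simp [Matrix.mulVec_mulVec, Matrix.mul_nonsing_inv _ hu]
  · simp only at ht
    rw [← ht, Matrix.mulVec_mulVec, Matrix.nonsing_inv_mul _ hu, Matrix.one_mulVec]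

/-- If `q` satisfies all linear relations `f_I(q) = f_I(z)` and agrees with `z_j + ∑_l b_j^l t_l`
on a basis, then it does so everywhere. -/
theorem eq_affine_of_eq_on_basis (b : Matrix (Fin n) (Fin k) ℂ) {i : Fin k → Fin n}
    (hi : Function.Injective i) (hd : d b i ≠ 0) (z q : Fin n → R) (t : Fin k → R)
    (hq : ∀ m, z (i m) + ∑ l, b (i m) l • t l = q (i m))
    (hlin : ∀ i' : Fin (k + 1) → Fin n, Function.Injective i' →
      ∑ m : Fin (k + 1), ((-1) ^ (m : ℕ) * d b (i' ∘ m.succAbove)) • (z (i' m) - q (i' m)) = 0)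
    (j : Fin n) : z j + ∑ l, b j l • t l = q j := by
  by_cases hj : j ∈ Set.range i
  · obtain ⟨m, rfl⟩ := hj
    exact hq m
  -- In the relation for `(j, i₁, …, i_k)` the basis terms cancel, leaving the term of `j` with the
  -- invertible coefficient `d b i`.
  have h1 := hlin (Fin.cons j i) (Fin.cons_injective_iff.2 ⟨hj, hi⟩)
  have h2 := sum_d_smul_affine b (Fin.cons j i) z t
  simp only [smul_sub, Finset.sum_sub_distrib] at h1
  rw [sub_eq_zero, ← h2, Fin.sum_univ_succ, Fin.sum_univ_succ] at h1
  simp only [Fin.cons_zero, Fin.cons_succ, hq] at h1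
  have h3 := add_right_cancel h1
  have h4 : (Fin.cons j i : Fin (k + 1) → Fin n) ∘ Fin.succAbove 0 = i := by
    ext m
    simp
  rw [h4] at h3
  simpa only [Fin.val_zero, pow_zero, one_mul, (IsUnit.mk0 _ hd).smul_left_cancel] using h3

end Determinants

/-! ### The isomorphism -/

section Isomorphism

open MvPolynomial

variable {n k : ℕ} {R : Type*} [CommRing R] [Algebra ℂ R]

theorem aDivF_mul_restrictHom_f (b : Matrix (Fin n) (Fin k) ℂ) (a : Fin n → ℂ) (j : Fin n) :
    aDivF b a j * restrictHom (U0 b) (f b j) = algebraMap ℂ _ (a j) := by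
  ext x
  simpa [aDivF, quotient] using div_mul_cancel₀ (a j) (x.2.1 j)

theorem map_f (φ : MvPolynomial (Fin n ⊕ Fin k) ℂ →ₐ[ℂ] R) (b : Matrix (Fin n) (Fin k) ℂ)
    (j : Fin n) :
    φ (f b j) = φ (X (Sum.inl j)) + ∑ l, b j l • φ (X (Sum.inr l)) := by
  simp [f, Algebra.smul_def]

theorem map_derivPhi {b : Matrix (Fin n) (Fin k) ℂ} (φ : regularFunctions (U0 b) →ₐ[ℂ] R)
    (a : Fin n → ℂ) (m : Fin k) :
    φ (derivPhi b a m) = ∑ j, b j m • φ (aDivF b a j) := by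
  simp only [derivPhi, map_sum, map_smul]

theorem map_firstKind {b : Matrix (Fin n) (Fin k) ℂ} (φ : regularFunctions (phaseSpace b) →ₐ[ℂ] R)
    (i : Fin (k - 1) → Fin n) :
    φ (firstKind b i) = ∑ j, d b (prepend j i) • φ (pCoord b j) := by
  simp only [firstKind, map_sum, map_smul]

/-- The image of a relation of second kind, when the `p_j` have images dividing the `a_j`. -/
theorem map_secondKind {b : Matrix (Fin n) (Fin k) ℂ} (φ : regularFunctions (phaseSpace b) →ₐ[ℂ] R)
    (a : Fin n → ℂ) (i : Fin (k + 1) → Fin n) (q : Fin n → R)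
    (hq : ∀ j, φ (pCoord b j) * q j = algebraMap ℂ R (a j)) :
    φ (secondKind b a i) = (∏ m, φ (pCoord b (i m))) *
      ∑ m : Fin (k + 1), ((-1) ^ (m : ℕ) * d b (i ∘ m.succAbove)) •
        (φ (zCoord b (i m)) - q (i m)) := by
  rw [← secondKind_factorization b a i (fun j => φ (zCoord b j)) (fun j => φ (pCoord b j)) q hq]
  simp only [secondKind, map_add, map_mul, map_sum, map_smul, map_prod]

theorem isUnit_pCoord (b : Matrix (Fin n) (Fin k) ℂ) (j : Fin n) : IsUnit (pCoord b j) :=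
  isUnit_restrictHom (P := X (Sum.inr j)) _ fun y hy => by simpa using hy.2 j

/-- A homomorphism from `𝒪(U⁰)` that kills the `∂Φ/∂t_m` induces one from
`𝒪((ℂⁿ - Δ) × (ℂ^×)ⁿ)` that kills the relations of both kinds. -/
theorem exists_phaseSpace_hom (b : Matrix (Fin n) (Fin k) ℂ) (a : Fin n → ℂ)
    (hk : 0 < k) (ha : ∀ j, a j ≠ 0) (π : regularFunctions (U0 b) →ₐ[ℂ] R)
    (hπ : ∀ F ∈ critIdeal b a, π F = 0) :
    ∃ ψ : regularFunctions (phaseSpace b) →ₐ[ℂ] R,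
      (∀ j, ψ (zCoord b j) = π (coord (U0 b) (Sum.inl j))) ∧
      (∀ j, ψ (pCoord b j) = π (aDivF b a j)) ∧ ∀ F ∈ relIdeal b a, ψ F = 0 := by
  obtain ⟨k, rfl⟩ : ∃ k', k = k' + 1 := ⟨k - 1, by omega⟩
  have hpf (j) : π (aDivF b a j) * π (restrictHom _ (f b j)) = algebraMap ℂ _ (a j) := by
    rw [← map_mul, aDivF_mul_restrictHom_f, AlgHom.commutes]
  have hpu (j) : IsUnit (π (aDivF b a j)) := by
    refine isUnit_of_mul_isUnit_left (y := π (restrictHom _ (f b j))) ?_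
    rw [hpf]
    exact (IsUnit.mk0 _ (ha j)).map _
  let φ : MvPolynomial (Fin n ⊕ Fin n) ℂ →ₐ[ℂ] R :=
    aeval (Sum.elim (fun j => π (coord (U0 b) (Sum.inl j))) fun j => π (aDivF b a j))
  have hφ : IsUnit (φ ((∏ j, X (Sum.inr j)) * discriminantPoly (Fin n) b)) := by
    rw [map_mul, map_prod]
    refine IsUnit.mul ?_ ?_
    · exact IsUnit.prod_univ_iff.2 fun j => by simpa [φ] using hpu j
    -- The discriminant involves only the `z_j`, so its invertibility carries over from `U⁰`.
    · rw [map_discriminantPoly_congr b φ (π.comp (restrictHom _)) fun j => by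
        simp [φ, restrictHom_X]]
      exact (isUnit_discriminantPoly b fun x hx => hx.2).map π
  obtain ⟨ψ, hψ⟩ := exists_lift_restrictHom (mem_phaseSpace_iff b) φ hφ
  have hz (j) : ψ (zCoord b j) = π (coord (U0 b) (Sum.inl j)) := by
    exact (hψ (X (Sum.inl j))).trans (by simp [φ])
  have hp (j) : ψ (pCoord b j) = π (aDivF b a j) := by
    exact (hψ (X (Sum.inr j))).trans (by simp [φ])
  have hker : ∀ F ∈ relIdeal b a, ψ F = 0 := by
    suffices relIdeal b a ≤ RingHom.ker ψ from this
    refine Ideal.span_le.2 ?_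
    rintro _ (⟨i, -, rfl⟩ | ⟨i, -, rfl⟩) <;> rw [SetLike.mem_coe, RingHom.mem_ker]
    · rw [map_firstKind]
      refine (sum_d_prepend_smul b i _).trans (Finset.sum_eq_zero fun m _ => ?_)
      simp only [hp]
      rw [← map_derivPhi]
      rw [hπ _ (Ideal.subset_span ⟨m, rfl⟩), smul_zero]
    · rw [map_secondKind ψ a i (fun j => π (restrictHom _ (f b j))) fun j => by rw [hp, hpf]]
      have := sum_d_smul_affine b i (fun j => π (coord (U0 b) (Sum.inl j)))
        (fun l => π (coord (U0 b) (Sum.inr l)))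
      have hf (j) : π (restrictHom _ (f b j)) = π (coord (U0 b) (Sum.inl j)) +
          ∑ l, b j l • π (coord (U0 b) (Sum.inr l)) :=
        map_f (π.comp (restrictHom _)) b j
      simp only [hz, hf, smul_sub, Finset.sum_sub_distrib]
      rw [this, sub_self, mul_zero]
  exact ⟨ψ, hz, hp, hker⟩

/-- A homomorphism from `𝒪((ℂⁿ - Δ) × (ℂ^×)ⁿ)` that kills the relations of both kinds induces
one from `𝒪(U⁰)` that kills the `∂Φ/∂t_m`. -/
theorem exists_U0_hom (b : Matrix (Fin n) (Fin k) ℂ) (a : Fin n → ℂ)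
    (hk : 0 < k) (ha : ∀ j, a j ≠ 0) {i : Fin k → Fin n} (hi : Function.Injective i) (hd : d b i ≠ 0)
    (π : regularFunctions (phaseSpace b) →ₐ[ℂ] R)
    (hπ : ∀ F ∈ relIdeal b a, π F = 0) :
    ∃ ψ : regularFunctions (U0 b) →ₐ[ℂ] R,
      (∀ j, ψ (coord (U0 b) (Sum.inl j)) = π (zCoord b j)) ∧
      (∀ j, ψ (aDivF b a j) = π (pCoord b j)) ∧ ∀ F ∈ critIdeal b a, ψ F = 0 := by
  obtain ⟨k, rfl⟩ : ∃ k', k = k' + 1 := ⟨k - 1, by omega⟩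
  have hpu (j) : IsUnit (π (pCoord b j)) := (isUnit_pCoord b j).map π
  -- `q_j = a_j / p_j` is the intended image of `f_j`.
  choose q hpq using fun j =>
    (hpu j).dvd (a := algebraMap ℂ R (a j))
  replace hpq (j) : π (pCoord b j) * q j = algebraMap ℂ _ (a j) := (hpq j).symm
  have hqu (j) : IsUnit (q j) := by
    refine isUnit_of_mul_isUnit_right (x := π (pCoord b j)) ?_
    rw [hpq]
    exact (IsUnit.mk0 _ (ha j)).map _
  have hlin (i' : Fin (k + 1 + 1) → Fin n) (hi' : Function.Injective i') :
      ∑ m : Fin (k + 1 + 1), ((-1) ^ (m : ℕ) * d b (i' ∘ m.succAbove)) •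
        (π (zCoord b (i' m)) - q (i' m)) = 0 := by
    have h0 := hπ _ (Ideal.subset_span (Or.inr ⟨i', hi', rfl⟩))
    rw [map_secondKind π a i' q hpq] at h0
    exact (IsUnit.prod_univ_iff.2 fun m => hpu (i' m)).mul_right_eq_zero.1 h0
  -- The images of the coordinates `t_l` come from `k` of the equations `f_j = q_j`; the second-kind
  -- relations then give the remaining ones.
  obtain ⟨t, ht, -⟩ := exists_unique_solution b hd fun m => q (i m) - π (zCoord b (i m))
  have hq (j) : π (zCoord b j) + ∑ l, b j l • t l = q j :=
    eq_affine_of_eq_on_basis b hi hd (fun j => π (zCoord b j)) q t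
      (fun m => by rw [ht m]; ring) hlin j
  let φ : MvPolynomial (Fin n ⊕ Fin (k + 1)) ℂ →ₐ[ℂ] R :=
    aeval (Sum.elim (fun j => π (zCoord b j)) t)
  have hf (j) : φ (f b j) = q j := by
    rw [map_f, ← hq j]
    simp [φ]
  have hφ : IsUnit (φ ((∏ j, f b j) * discriminantPoly (Fin (k + 1)) b)) := by
    rw [map_mul, map_prod]
    refine IsUnit.mul ?_ ?_
    · exact IsUnit.prod_univ_iff.2 fun j => by rw [hf]; exact hqu j
    · rw [map_discriminantPoly_congr b φ (π.comp (restrictHom _)) fun j => by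
        simp [φ, restrictHom_X, zCoord]]
      exact (isUnit_discriminantPoly b fun x hx => hx.1).map π
  obtain ⟨ψ, hψ⟩ := exists_lift_restrictHom (mem_U0_iff b) φ hφ
  have hz (j) : ψ (coord (U0 b) (Sum.inl j)) = π (zCoord b j) := by
    exact (hψ (X (Sum.inl j))).trans (by simp [φ])
  have hp (j) : ψ (aDivF b a j) = π (pCoord b j) := by
    refine (hqu j).mul_right_cancel ?_
    rw [hpq, ← hf, ← hψ, ← map_mul, aDivF_mul_restrictHom_f, AlgHom.commutes]
  have hker : ∀ F ∈ critIdeal b a, ψ F = 0 := by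
    suffices critIdeal b a ≤ RingHom.ker ψ from this
    refine Ideal.span_le.2 ?_
    rintro _ ⟨m, rfl⟩
    rw [SetLike.mem_coe, RingHom.mem_ker, map_derivPhi]
    simp only [hp]
    refine sum_smul_eq_zero_of_firstKind b _ hi hd (fun i' hi' => ?_) m
    have h0 := hπ _ (Ideal.subset_span (Or.inl ⟨i', hi', rfl⟩))
    rwa [map_firstKind] at h0
  exact ⟨ψ, hz, hp, hker⟩

theorem phaseSpace_hom_ext {b : Matrix (Fin n) (Fin k) ℂ}
    {φ ψ : regularFunctions (phaseSpace b) →ₐ[ℂ] R}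
    (hz : ∀ j, φ (zCoord b j) = ψ (zCoord b j))
    (hp : ∀ j, φ (pCoord b j) = ψ (pCoord b j)) : φ = ψ := by
  refine algHom_ext_coord (mem_phaseSpace_iff b) ?_
  rintro (j | j)
  exacts [hz j, hp j]

/-- Since `a_j` is invertible, the image of `a_j / f_j` fixes that of `f_j`; the values of `f_j -
z_j` at `i₁, …, i_k` then fix the images of the `t_l` by Cramer's rule. -/
theorem U0_hom_ext {b : Matrix (Fin n) (Fin k) ℂ} {a : Fin n → ℂ}
    (ha : ∀ j, a j ≠ 0) {i : Fin k → Fin n} (hd : d b i ≠ 0)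
    {φ ψ : regularFunctions (U0 b) →ₐ[ℂ] R}
    (hz : ∀ j, φ (coord (U0 b) (Sum.inl j)) = ψ (coord (U0 b) (Sum.inl j)))
    (hp : ∀ j, φ (aDivF b a j) = ψ (aDivF b a j)) : φ = ψ := by
  refine algHom_ext_coord (mem_U0_iff b) ?_
  have hpf (χ : regularFunctions (U0 b) →ₐ[ℂ] R) (j) :
      χ (aDivF b a j) * χ (restrictHom _ (f b j)) = algebraMap ℂ _ (a j) := by
    rw [← map_mul, aDivF_mul_restrictHom_f, AlgHom.commutes]
  have hf (j) : φ (restrictHom _ (f b j)) = ψ (restrictHom _ (f b j)) := by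
    have hu : IsUnit (φ (aDivF b a j)) := by
      refine isUnit_of_mul_isUnit_left (y := φ (restrictHom _ (f b j))) ?_
      rw [hpf]
      exact (IsUnit.mk0 _ (ha j)).map _
    refine hu.mul_left_cancel ?_
    rw [hpf φ, ← hpf ψ, hp]
  have haff (χ : regularFunctions (U0 b) →ₐ[ℂ] R) (j) :
      ∑ l, b j l • χ (coord (U0 b) (Sum.inr l)) =
        χ (restrictHom _ (f b j)) - χ (coord (U0 b) (Sum.inl j)) := by
    rw [eq_sub_iff_add_eq']
    exact (map_f (χ.comp (restrictHom _)) b j).symm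
  have ht : (fun l => φ (coord (U0 b) (Sum.inr l))) =
      fun l => ψ (coord (U0 b) (Sum.inr l)) := by
    refine (exists_unique_solution b hd fun m => φ (restrictHom _ (f b (i m))) -
      φ (coord (U0 b) (Sum.inl (i m)))).unique (fun m => haff φ (i m)) fun m => ?_
    rw [haff ψ (i m), hf, hz]
  rintro (j | l)
  exacts [hz j, congrFun ht l]

/-- The homomorphism `Ã → A_Φ`. -/
theorem exists_relAlgebra_hom (b : Matrix (Fin n) (Fin k) ℂ) (a : Fin n → ℂ)
    (hk : 0 < k) (ha : ∀ j, a j ≠ 0) :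
    ∃ Φ : RelAlgebra b a →ₐ[ℂ] CritAlgebra b a,
      (∀ j, Φ (Ideal.Quotient.mk (relIdeal b a) (zCoord b j)) =
        Ideal.Quotient.mk (critIdeal b a) (coord (U0 b) (Sum.inl j))) ∧
      ∀ j, Φ (Ideal.Quotient.mk (relIdeal b a) (pCoord b j)) =
        Ideal.Quotient.mk (critIdeal b a) (aDivF b a j) := by
  have hπ : ∀ F ∈ critIdeal b a, Ideal.Quotient.mkₐ ℂ (critIdeal b a) F = 0 :=
    fun F hF => Ideal.Quotient.eq_zero_iff_mem.2 hF
  obtain ⟨ψ, hz, hp, hker⟩ := exists_phaseSpace_hom (R := CritAlgebra b a) b a hk ha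
    (Ideal.Quotient.mkₐ ℂ (critIdeal b a)) hπ
  exact ⟨Ideal.Quotient.liftₐ _ ψ hker, hz, hp⟩

/-- The homomorphism `A_Φ → Ã`. -/
theorem exists_critAlgebra_hom (b : Matrix (Fin n) (Fin k) ℂ) (a : Fin n → ℂ)
    (hk : 0 < k) (ha : ∀ j, a j ≠ 0) {i : Fin k → Fin n} (hi : Function.Injective i) (hd : d b i ≠ 0) :
    ∃ Ψ : CritAlgebra b a →ₐ[ℂ] RelAlgebra b a,
      (∀ j, Ψ (Ideal.Quotient.mk (critIdeal b a) (coord (U0 b) (Sum.inl j))) =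
        Ideal.Quotient.mk (relIdeal b a) (zCoord b j)) ∧
      ∀ j, Ψ (Ideal.Quotient.mk (critIdeal b a) (aDivF b a j)) =
        Ideal.Quotient.mk (relIdeal b a) (pCoord b j) := by
  have hπ : ∀ F ∈ relIdeal b a, Ideal.Quotient.mkₐ ℂ (relIdeal b a) F = 0 :=
    fun F hF => Ideal.Quotient.eq_zero_iff_mem.2 hF
  obtain ⟨ψ, hz, hp, hker⟩ := exists_U0_hom (R := RelAlgebra b a) b a hk ha hi hd
    (Ideal.Quotient.mkₐ ℂ (relIdeal b a)) hπ
  exact ⟨Ideal.Quotient.liftₐ _ ψ hker, hz, hp⟩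

theorem relAlgebra_hom_ext {b : Matrix (Fin n) (Fin k) ℂ} {a : Fin n → ℂ}
    {φ ψ : RelAlgebra b a →ₐ[ℂ] R}
    (hz : ∀ j, φ (Ideal.Quotient.mk (relIdeal b a) (zCoord b j)) =
      ψ (Ideal.Quotient.mk (relIdeal b a) (zCoord b j)))
    (hp : ∀ j, φ (Ideal.Quotient.mk (relIdeal b a) (pCoord b j)) =
      ψ (Ideal.Quotient.mk (relIdeal b a) (pCoord b j))) : φ = ψ :=
  Ideal.Quotient.algHom_ext _ (phaseSpace_hom_ext hz hp)

theorem critAlgebra_hom_ext {b : Matrix (Fin n) (Fin k) ℂ} {a : Fin n → ℂ}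
    (ha : ∀ j, a j ≠ 0) {i : Fin k → Fin n} (hd : d b i ≠ 0) {φ ψ : CritAlgebra b a →ₐ[ℂ] R}
    (hz : ∀ j, φ (Ideal.Quotient.mk (critIdeal b a) (coord (U0 b) (Sum.inl j))) =
      ψ (Ideal.Quotient.mk (critIdeal b a) (coord (U0 b) (Sum.inl j))))
    (hp : ∀ j, φ (Ideal.Quotient.mk (critIdeal b a) (aDivF b a j)) =
      ψ (Ideal.Quotient.mk (critIdeal b a) (aDivF b a j))) : φ = ψ :=
  Ideal.Quotient.algHom_ext _ (U0_hom_ext ha hd hz hp)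

end Isomorphism

end GenericArrangement

/-! ### Assembly of the two mutually inverse homomorphisms -/

theorem theorem3p2 {n k : ℕ} (hk : 0 < k) (hkn : k < n)
    (b : Matrix (Fin n) (Fin k) ℂ)
    (hb : ∀ i : Fin k → Fin n, Function.Injective i → GenericArrangement.d b i ≠ 0)
    (a : Fin n → ℂ) (ha : ∀ j, a j ≠ 0) (hsum : ∑ j, a j ≠ 0) :
    ∃! e : GenericArrangement.RelAlgebra b a ≃ₐ[ℂ] GenericArrangement.CritAlgebra b a,
      (∀ j : Fin n,
        e (Ideal.Quotient.mk (GenericArrangement.relIdeal b a) (GenericArrangement.zCoord b j)) =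
          Ideal.Quotient.mk (GenericArrangement.critIdeal b a)
            (GenericArrangement.coord (GenericArrangement.U0 b) (Sum.inl j))) ∧
      (∀ j : Fin n,
        e (Ideal.Quotient.mk (GenericArrangement.relIdeal b a) (GenericArrangement.pCoord b j)) =
          Ideal.Quotient.mk (GenericArrangement.critIdeal b a)
            (GenericArrangement.aDivF b a j)) := by
  -- By genericity any `k` distinct rows of `b` form a basis; the first `k` are used.
  have hi : Function.Injective (Fin.castLE hkn.le) := Fin.castLE_injective _
  have hd := hb _ hi
  obtain ⟨Φ, hΦz, hΦp⟩ := GenericArrangement.exists_relAlgebra_hom b a hk ha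
  obtain ⟨Ψ, hΨz, hΨp⟩ := GenericArrangement.exists_critAlgebra_hom b a hk ha hi hd
  refine ⟨AlgEquiv.ofAlgHom Φ Ψ ?_ ?_, ⟨hΦz, hΦp⟩, ?_⟩
  · refine GenericArrangement.critAlgebra_hom_ext (R := GenericArrangement.CritAlgebra b a) ha hd (fun j => ?_) fun j => ?_
    · exact (congrArg Φ (hΨz j)).trans (hΦz j)
    · exact (congrArg Φ (hΨp j)).trans (hΦp j)
  · refine GenericArrangement.relAlgebra_hom_ext (R := GenericArrangement.RelAlgebra b a) (fun j => ?_) fun j => ?_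
    · exact (congrArg Ψ (hΦz j)).trans (hΨz j)
    · exact (congrArg Ψ (hΦp j)).trans (hΨp j)
  · rintro e ⟨hez, hep⟩
    have : e.toAlgHom = Φ :=
      GenericArrangement.relAlgebra_hom_ext (R := GenericArrangement.CritAlgebra b a) (fun j => (hez j).trans (hΦz j).symm)
        fun j => (hep j).trans (hΦp j).symm
    exact AlgEquiv.ext fun x => DFunLike.congr_fun this x
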